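/- For $n,d\in\mathbb N$, $b,B>0$ and $\sigma:\mathbb R\to\mathbb R$ applied element-wise, let \[ \mathcal F^{\sigma}_{b,B,n,d}=\left\{\mathbf x\mapsto \mathbf u^\top\sigma(W\mathbf x)\;:\;\mathbf u\in\mathbb R^n,\ W\in\mathbb R^{n\times d},\ \|\mathbf u\|\le b,\ \|W\|_F\le B\right\}, \] where $\|\cdot\|$ is the Euclidean norm and $\|\cdot\|_F$ the Frobenius norm. A class $\mathcal F$ of real functions shatters $m$ distinct points $\mathbf x_1,\dots,\mathbf x_m$ with margin $\epsilon$ if there is a number $s$ such that for every $\mathbf y\in\{0,1\}^m$ some $f\in\mathcal F$ satisfies, for all $i$, $f(\mathbf x_i)\le s-\epsilon$ if $y_i=0$ and $f(\mathbf x_i)\ge s+\epsilon$ if $y_i=1$. Write $[z]_+=\max\{z,0\}$. There are universal constants $C,C',c>0$ and $k,k',d_0\in\mathbb N$ such that the following holds for all $b,B,b_x,\epsilon>0$ and all integers $n\ge 1$ and $d\ge d_0$. Put \[ \Lambda=C\log^{k}\!\left(3+d+n+b+B+b_x+\tfrac1\epsilon\right),\qquad \Lambda'=C'\log^{k'}\!\left(3+d+n+b+B+b_x+\tfrac1\epsilon\right),\qquad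 M=\frac1\Lambda\min\left\{nd,\ \frac{bBb_x}{\epsilon}\sqrt d\right\}. \] Call $\beta$ admissible if $0\le\beta\le\Lambda\frac{Bb_x}{\sqrt{dn}}$ and, for $\sigma(z)=[z-\beta]_+$, the class $\mathcal F^{\sigma}_{b,B,n,d}$ can shatter at least $M$ points from $\{\mathbf x\in\mathbb R^d:\|\mathbf x\|\le b_x\}$ with margin $\epsilon$. (i) If $M>cd$, then an admissible $\beta$ exists; and if some admissible $\beta$ satisfies $\beta\le\frac{Bb_x}{\sqrt n}$, then also for the standard ReLU activation $\sigma(z)=[z]_+$ the class $\mathcal F^{\sigma}_{b,B,n,d}$ can shatter at least $M$ points from $\{\mathbf x\in\mathbb R^d:\|\mathbf x\|\le b_x\}$ with margin $\epsilon$. (ii) If $d\ge\Lambda'$, then every $\beta\in\left[0,\Lambda\frac{Bb_x}{\sqrt{dn}}\right]$, in particular every admissible $\beta$, satisfies $\beta\le\frac{Bb_x}{\sqrt n}$. -/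

import Mathlib

/-- The ReLU function `z ↦ [z]_+ = max {z, 0}`. -/
noncomputable def relu (z : ℝ) : ℝ := max z 0

section FrobeniusClass

attribute [local instance] Matrix.frobeniusNormedAddCommGroup

/-- The class of one-hidden-layer networks `x ↦ uᵀ σ(W x)` of width `n` on `ℝ^d`, where
`u ∈ ℝ^n` has Euclidean norm at most `b` and `W ∈ ℝ^{n × d}` has Frobenius norm at most `B`
(inside this section `‖W‖` is the Frobenius norm of the matrix `W`). -/
def frobeniusClass (σ : ℝ → ℝ) (b B : ℝ) (n d : ℕ) : Set (EuclideanSpace ℝ (Fin d) → ℝ) :=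
  {f | ∃ (u : EuclideanSpace ℝ (Fin n)) (W : Matrix (Fin n) (Fin d) ℝ),
      ‖u‖ ≤ b ∧ ‖W‖ ≤ B ∧
      f = fun x => ∑ k, u k * σ (∑ j, W k j * x j)}

end FrobeniusClass

/-- The class `F` shatters the points `x 0, …, x (m - 1)` with margin `ε`, with one common
threshold `s` for all the points. -/
def Shatters {E : Type*} {m : ℕ} (F : Set (E → ℝ)) (x : Fin m → E) (ε : ℝ) : Prop :=
  ∃ s : ℝ, ∀ y : Fin m → Fin 2, ∃ f ∈ F, ∀ i,
    (y i = 0 → f (x i) ≤ s - ε) ∧ (y i = 1 → s + ε ≤ f (x i))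

/-- The class `F` can shatter at least `r` distinct points of `X` with margin `ε`. -/
def CanShatterAtLeast {E : Type*} (F : Set (E → ℝ)) (X : Set E) (r ε : ℝ) : Prop :=
  ∃ (m : ℕ) (x : Fin m → E), r ≤ m ∧ Function.Injective x ∧ (∀ i, x i ∈ X) ∧ Shatters F x ε

/-- The polylogarithmic factor `C · log^k (3 + d + n + b + B + b_x + 1/ε)`. -/
noncomputable def polylog (C : ℝ) (k n d : ℕ) (b B bx ε : ℝ) : ℝ :=
  C * Real.log (3 + d + n + b + B + bx + 1 / ε) ^ k

/-- The quantity `min {n d, (b B b_x / ε) √d}`. -/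
noncomputable def shatterRate (n d : ℕ) (b B bx ε : ℝ) : ℝ :=
  min ((n : ℝ) * d) (b * B * bx / ε * √(d : ℝ))

/-- `β` is an admissible bias, up to the polylogarithmic factor `L`:
`0 ≤ β ≤ L · B b_x / √(d n)`, and the class with activation `z ↦ [z - β]_+` can shatter at least
`min {n d, (b B b_x / ε) √d} / L` points of norm at most `b_x` with margin `ε`. -/
def AdmissibleBias (L : ℝ) (n d : ℕ) (b B bx ε β : ℝ) : Prop :=
  0 ≤ β ∧ β ≤ L * (B * bx / √((d : ℝ) * n)) ∧
    CanShatterAtLeast (frobeniusClass (fun z => relu (z - β)) b B n d) {x | ‖x‖ ≤ bx}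
      (shatterRate n d b B bx ε / L) ε

open Finset Pointwise

/-! The bias is not needed: plain ReLU networks already shatter M points whenever M > d, so β = 0 is
admissible and both claims of (i) reduce to `canShatterAtLeast_shatterRate`. Claim (ii) amounts to Λ
≤ √d, which follows from d ≥ Λ' once Λ' = Λ².

Write l for the logarithm and T = b B b_x / ε. For d ≥ 10^6 l^4 (`canShatterAtLeast_high_dim`) the
points come from Reed–Solomon vectors with pairwise inner products O(l / √d). Given labels, colour
the points at random with about min(n, T / √d) colours; neuron k sums the positive points of colour
k and subtracts the average over colours. Centring removes the mean of the cross terms, a Chernoff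
bound makes the rest small, and each positive point is detected by the neuron of its own colour.

For d ≤ 10^6 l^4 (`canShatterAtLeast_low_dim`) the factors of d are absorbed by Λ, so a number of
points proportional to min(n, T) suffices. They form a grid of N^4 points in dimension 4. The labels
are expanded in a discrete Fourier series, each cosine is an exact combination of ReLU ridges,
Parseval controls the total weight, and Carathéodory's theorem the width. With D grid coordinates
the weight is of order N^(D/2 + 2) against N^D points, and D = 4 balances the two. -/

/-! ### ReLU identities, padding and rescaling of networks. -/

theorem relu_mul_of_nonneg {c : ℝ} (hc : 0 ≤ c) (z : ℝ) : relu (c * z) = c * relu z := by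
  unfold relu; rw [mul_max_of_nonneg _ _ hc, mul_zero]

theorem relu_of_nonneg {z : ℝ} (hz : 0 ≤ z) : relu z = z := max_eq_left hz

theorem relu_of_nonpos {z : ℝ} (hz : z ≤ 0) : relu z = 0 := max_eq_right hz

theorem relu_nonneg (z : ℝ) : 0 ≤ relu z := le_max_right _ _

theorem le_relu (z : ℝ) : z ≤ relu z := le_max_left _ _

theorem CanShatterAtLeast.mono_rate {E : Type*} {F : Set (E → ℝ)} {X : Set E} {r r' ε : ℝ}
    (h : CanShatterAtLeast F X r ε) (hr : r' ≤ r) : CanShatterAtLeast F X r' ε := by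
  obtain ⟨m, x, hm, h⟩ := h
  exact ⟨m, x, hr.trans hm, h⟩

theorem sum_extend_zero {α γ : Type*} [Fintype α] [Fintype γ] (e : α ↪ γ) (v : α → ℝ)
    (φ : γ → ℝ → ℝ) (hφ : ∀ c, φ c 0 = 0) :
    ∑ c, φ c (Function.extend e v 0 c) = ∑ a, φ (e a) (v a) := by
  classical
  symm
  rw [← Finset.sum_subset (Finset.subset_univ (Finset.univ.map e)), Finset.sum_map]
  · exact Finset.sum_congr rfl fun a _ => by rw [e.injective.extend_apply]
  · intro c _ hc
    rw [Function.extend_apply', Pi.zero_apply, hφ]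
    rintro ⟨a, rfl⟩
    exact hc (Finset.mem_map_of_mem e (Finset.mem_univ a))

/-- Membership in the class for a network whose neurons and input coordinates are indexed by
arbitrary finite types embedded in `Fin n` and `Fin d`. -/
theorem network_mem_frobeniusClass {ι κ : Type*} [Fintype ι] [Fintype κ] {n d : ℕ} {b B : ℝ}
    (e : ι ↪ Fin d) (hn : Fintype.card κ ≤ n) (hb : 0 ≤ b) (hB : 0 ≤ B)
    (u : κ → ℝ) (w : κ → ι → ℝ) (hu : ∑ k, u k ^ 2 ≤ b ^ 2) (hw : ∑ k, ∑ j, w k j ^ 2 ≤ B ^ 2) :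
    ∃ f ∈ frobeniusClass relu b B n d, ∀ x : EuclideanSpace ℝ (Fin d),
      f x = ∑ k, u k * relu (∑ j, w k j * x (e j)) := by
  classical
  obtain ⟨g⟩ := Function.Embedding.nonempty_of_card_le (α := κ) (β := Fin n) (by simpa using hn)
  set U : Fin n → ℝ := Function.extend g u 0 with hU
  set W : Fin n → Fin d → ℝ := Function.extend g (fun k => Function.extend e (w k) 0) 0 with hW
  have hWg : ∀ k, W (g k) = Function.extend e (w k) 0 := fun k => g.injective.extend_apply _ _ _
  have hW0 : ∀ k, k ∉ Set.range g → W k = 0 := fun k hk => by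
    rw [hW, Function.extend_apply' _ _ _ (by simpa using hk)]; rfl
  refine ⟨fun x => ∑ k, U k * relu (∑ j, W k j * x j), ⟨WithLp.toLp 2 U, Matrix.of W, ?_, ?_, ?_⟩, ?_⟩
  · rw [EuclideanSpace.norm_eq]
    apply Real.sqrt_le_iff.2 ⟨hb, ?_⟩
    have := sum_extend_zero g u (fun _ z => z ^ 2) (by simp)
    simp only [Real.norm_eq_abs, sq_abs]
    exact this.trans_le hu
  · rw [Matrix.frobenius_norm_def, ← Real.sqrt_eq_rpow]
    apply Real.sqrt_le_iff.2 ⟨hB, ?_⟩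
    refine le_trans (le_of_eq ?_) hw
    have h1 : ∀ i, ∑ j, ‖(Matrix.of W) i j‖ ^ (2 : ℝ) = ∑ j, W i j ^ 2 := fun i =>
      Finset.sum_congr rfl fun j _ => by
        rw [Real.rpow_two, Real.norm_eq_abs, sq_abs]; rfl
    simp_rw [h1]
    rw [← Finset.sum_subset (Finset.subset_univ (Finset.univ.map g)), Finset.sum_map]
    · refine Finset.sum_congr rfl fun k _ => ?_
      rw [hWg]
      exact sum_extend_zero e (w k) (fun _ z => z ^ 2) (by simp)
    · intro k _ hk
      rw [hW0 k (by simpa using hk)]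
      simp
  · rfl
  · intro x
    change ∑ k, U k * relu (∑ j, W k j * x j) = _
    rw [hU, sum_extend_zero g u (fun k z => z * relu (∑ j, W k j * x j)) (by simp)]
    refine Finset.sum_congr rfl fun k _ => ?_
    rw [hWg, sum_extend_zero e (w k) (fun j z => z * x j) (by simp)]

/-- A normalized criterion: unit margin on the unit ball, with the product of the squared norms of
the two layers at most `(b B b_x / ε)²`. -/
theorem canShatterAtLeast_of_networks {ι P : Type*} [Fintype ι] [Fintype P] (x : P → ι → ℝ)
    (hx : Function.Injective x) (hx1 : ∀ p, ∑ j, x p j ^ 2 ≤ 1) {n d : ℕ} {b B bx ε : ℝ}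
    (hb : 0 < b) (hB : 0 < B) (hbx : 0 < bx) (hε : 0 < ε) (hd : Fintype.card ι ≤ d) (s : ℝ)
    (H : ∀ y : P → Fin 2, ∃ (κ : Type) (_ : Fintype κ) (u : κ → ℝ) (w : κ → ι → ℝ) (S Q : ℝ),
      Fintype.card κ ≤ n ∧ 0 < S ∧ ∑ k, u k ^ 2 ≤ S ∧ ∑ k, ∑ j, w k j ^ 2 ≤ Q ∧
      S * Q ≤ (b * B * bx / ε) ^ 2 ∧
      ∀ p, (y p = 0 → ∑ k, u k * relu (∑ j, w k j * x p j) ≤ s - 1) ∧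
        (y p = 1 → s + 1 ≤ ∑ k, u k * relu (∑ j, w k j * x p j))) :
    CanShatterAtLeast (frobeniusClass relu b B n d) {x | ‖x‖ ≤ bx} (Fintype.card P) ε := by
  classical
  obtain ⟨e⟩ := Function.Embedding.nonempty_of_card_le (α := ι) (β := Fin d) (by simpa using hd)
  let E := Fintype.equivFin P
  have hval : ∀ p j, (WithLp.toLp 2 (Function.extend e (fun j => bx * x p j) 0) :
      EuclideanSpace ℝ (Fin d)) (e j) = bx * x p j := fun p j =>
    e.injective.extend_apply (fun j => bx * x p j) 0 j
  refine ⟨Fintype.card P, fun i => WithLp.toLp 2 (Function.extend e (fun j => bx * x (E.symm i) j) 0),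
    le_rfl, ?_, ?_, s * ε, ?_⟩
  · intro i i' h
    apply E.symm.injective
    apply hx
    funext j
    have h1 := hval (E.symm i) j
    simp only at h
    rw [h, hval] at h1
    exact (mul_left_cancel₀ hbx.ne' h1).symm
  · intro i
    rw [Set.mem_ofPred_eq, EuclideanSpace.norm_eq]
    apply Real.sqrt_le_iff.2 ⟨hbx.le, ?_⟩
    have := sum_extend_zero e (fun j => bx * x (E.symm i) j) (fun _ z => z ^ 2) (by simp)
    simp only [Real.norm_eq_abs, sq_abs]
    rw [this]
    simp_rw [mul_pow]
    rw [← Finset.mul_sum]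
    nlinarith [hx1 (E.symm i), sq_nonneg bx]
  · intro y
    obtain ⟨κ, _, u, w, S, Q, hκ, hS, hu, hw, hSQ, hf⟩ := H (y ∘ E)
    have hS' : 0 < √S := Real.sqrt_pos.2 hS
    have hSS : √S ^ 2 = S := Real.sq_sqrt hS.le
    -- By homogeneity only the product of the layer norms matters: the outer layer is scaled to norm
    -- at most b, and the inner one so that, with inputs scaled by `bx`, the output is multiplied by
    -- exactly ε.
    obtain ⟨f, hfm, hfe⟩ := network_mem_frobeniusClass e hκ hb.le hB.le (fun k => b / √S * u k)
      (fun k j => ε * √S / (b * bx) * w k j)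
      (by
        simp_rw [mul_pow]
        rw [← Finset.mul_sum, div_pow, hSS]
        calc b ^ 2 / S * ∑ k, u k ^ 2 ≤ b ^ 2 / S * S := by gcongr
          _ = b ^ 2 := by field_simp)
      (by
        simp_rw [mul_pow, ← Finset.mul_sum]
        rw [div_pow, mul_pow, hSS]
        calc ε ^ 2 * S / (b * bx) ^ 2 * ∑ k, ∑ j, w k j ^ 2 ≤ ε ^ 2 * S / (b * bx) ^ 2 * Q := by gcongr
          _ = ε ^ 2 / (b * bx) ^ 2 * (S * Q) := by ring
          _ ≤ ε ^ 2 / (b * bx) ^ 2 * (b * B * bx / ε) ^ 2 := by gcongr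
          _ = B ^ 2 := by field_simp)
    refine ⟨f, hfm, fun i => ?_⟩
    have key : f (WithLp.toLp 2 (Function.extend e (fun j => bx * x (E.symm i) j) 0)) =
        ε * ∑ k, u k * relu (∑ j, w k j * x (E.symm i) j) := by
      rw [hfe, Finset.mul_sum]
      refine Finset.sum_congr rfl fun k _ => ?_
      have : ∑ j, ε * √S / (b * bx) * w k j * (WithLp.toLp 2
          (Function.extend e (fun j => bx * x (E.symm i) j) 0) : EuclideanSpace ℝ (Fin d)) (e j) =
          ε * √S / b * ∑ j, w k j * x (E.symm i) j := by
        rw [Finset.mul_sum]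
        refine Finset.sum_congr rfl fun j _ => ?_
        rw [hval]
        field_simp
      rw [this, relu_mul_of_nonneg (by positivity)]
      field_simp
    rw [key]
    have := hf (E.symm i)
    simp only [Function.comp_apply, Equiv.apply_symm_apply] at this
    constructor
    · intro h; nlinarith [this.1 h]
    · intro h; nlinarith [this.2 h]

/-! ### The variation ball, and networks extracted from it. -/

section VariationBall

variable {ι P : Type} [Fintype ι]

/-- The values on the points `x` of the convex combinations of signed ReLU neurons of norm at most
one. -/
def variationBall (x : P → ι → ℝ) : Set (P → ℝ) :=
  convexHull ℝ {g | ∃ (a : ℝ) (w : ι → ℝ), |a| ≤ 1 ∧ ∑ j, w j ^ 2 ≤ 1 ∧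
    g = fun p => a * relu (∑ j, w j * x p j)}

theorem convex_variationBall (x : P → ι → ℝ) : Convex ℝ (variationBall x) := convex_convexHull ℝ _

theorem zero_mem_variationBall (x : P → ι → ℝ) : (0 : P → ℝ) ∈ variationBall x :=
  subset_convexHull ℝ _ ⟨0, 0, by simp, by simp, by ext; simp⟩

theorem sum_mem_smul_variationBall {α : Type*} (x : P → ι → ℝ) (s : Finset α) (g : α → P → ℝ)
    (τ : α → ℝ) (hτ : ∀ i ∈ s, 0 ≤ τ i) (hg : ∀ i ∈ s, g i ∈ τ i • variationBall x) :
    ∑ i ∈ s, g i ∈ (∑ i ∈ s, τ i) • variationBall x := by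
  classical
  induction s using Finset.induction_on with
  | empty => exact ⟨0, zero_mem_variationBall x, by simp⟩
  | insert a s ha ih =>
    rw [Finset.sum_insert ha, Finset.sum_insert ha, (convex_variationBall x).add_smul
      (hτ a (by simp)) (Finset.sum_nonneg fun i hi => hτ i (by simp [hi]))]
    exact Set.add_mem_add (hg a (by simp))
      (ih (fun i hi => hτ i (by simp [hi])) fun i hi => hg i (by simp [hi]))

theorem add_mem_smul_variationBall (x : P → ι → ℝ) {g h : P → ℝ} {τ τ' : ℝ} (hτ : 0 ≤ τ)
    (hτ' : 0 ≤ τ') (hg : g ∈ τ • variationBall x) (hh : h ∈ τ' • variationBall x) :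
    g + h ∈ (τ + τ') • variationBall x := by
  rw [(convex_variationBall x).add_smul hτ hτ']
  exact Set.add_mem_add hg hh

theorem mem_smul_variationBall_mono (x : P → ι → ℝ) {g : P → ℝ} {τ τ' : ℝ} (hτ : 0 ≤ τ)
    (h : τ ≤ τ') (hg : g ∈ τ • variationBall x) : g ∈ τ' • variationBall x := by
  have := add_mem_smul_variationBall x (h := 0) hτ (sub_nonneg.2 h) hg
    ⟨0, zero_mem_variationBall x, by simp⟩
  simpa using this

theorem neuron_mem_smul_variationBall (x : P → ι → ℝ) (c : ℝ) (w : ι → ℝ) {ρ : ℝ} (hρ : 0 < ρ)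
    (hw : ∑ j, w j ^ 2 ≤ ρ ^ 2) :
    (fun p => c * relu (∑ j, w j * x p j)) ∈ (|c| * ρ) • variationBall x := by
  refine ⟨fun p => SignType.sign c * relu (∑ j, ρ⁻¹ * w j * x p j),
    subset_convexHull ℝ _ ⟨_, fun j => ρ⁻¹ * w j, ?_, ?_, rfl⟩, ?_⟩
  · rcases lt_trichotomy c 0 with h | h | h <;> simp [h]
  · simp_rw [mul_pow]
    rw [← Finset.mul_sum, inv_pow]
    exact (inv_mul_le_iff₀ (by positivity)).2 (by linarith)
  · ext p
    simp only [Pi.smul_apply, smul_eq_mul, mul_assoc]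
    rw [← Finset.mul_sum, relu_mul_of_nonneg (by positivity)]
    have h : |c| * (SignType.sign c : ℝ) = c := by rw [mul_comm, sign_mul_abs]
    calc |c| * (ρ * ((SignType.sign c : ℝ) * (ρ⁻¹ * relu (∑ j, w j * x p j))))
        = (|c| * (SignType.sign c : ℝ)) * relu (∑ j, w j * x p j) * (ρ * ρ⁻¹) := by ring
      _ = _ := by rw [h, mul_inv_cancel₀ hρ.ne', mul_one]

/-- By Carathéodory's theorem, at most `|P| + 1` neurons suffice. -/
theorem exists_network_of_mem_smul_variationBall [Fintype P] (x : P → ι → ℝ) {g : P → ℝ}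
    {τ : ℝ} (hτ : 0 ≤ τ) (hg : g ∈ τ • variationBall x) :
    ∃ (κ : Type) (_ : Fintype κ) (u : κ → ℝ) (w : κ → ι → ℝ),
      Fintype.card κ ≤ Fintype.card P + 1 ∧ ∑ k, u k ^ 2 ≤ 1 ∧ ∑ k, ∑ j, w k j ^ 2 ≤ τ ^ 2 ∧
      ∀ p, ∑ k, u k * relu (∑ j, w k j * x p j) = g p := by
  obtain ⟨h, hh, rfl⟩ := hg
  obtain ⟨κ, _, z, r, hz, haff, hr, hr1, hsum⟩ := eq_pos_convex_span_of_mem_convexHull hh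
  choose a w ha hw hzw using fun k => hz (Set.mem_range_self k)
  -- Each convex weight is split as √r · √r between the two layers, which turns the ℓ¹ budget of the
  -- combination into ℓ² budgets 1 and τ².
  refine ⟨κ, inferInstance, fun k => √(r k) * a k, fun k j => τ * √(r k) * w k j, ?_, ?_, ?_, ?_⟩
  · have h1 := haff.card_le_finrank_succ
    have h2 := Submodule.finrank_le (vectorSpan ℝ (Set.range z))
    rw [Module.finrank_pi] at h2
    omega
  · rw [← hr1]
    refine Finset.sum_le_sum fun k _ => ?_
    rw [mul_pow, Real.sq_sqrt (hr k).le]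
    have : a k ^ 2 ≤ 1 := (sq_le_one_iff_abs_le_one _).2 (ha k)
    nlinarith [hr k]
  · calc ∑ k, ∑ j, (τ * √(r k) * w k j) ^ 2 = ∑ k, τ ^ 2 * r k * ∑ j, w k j ^ 2 := by
          refine Finset.sum_congr rfl fun k _ => ?_
          rw [Finset.mul_sum]
          refine Finset.sum_congr rfl fun j _ => ?_
          rw [mul_pow, mul_pow, Real.sq_sqrt (hr k).le]
      _ ≤ ∑ k, τ ^ 2 * r k * 1 := by
          refine Finset.sum_le_sum fun k _ => ?_
          have := (hr k).le
          exact mul_le_mul_of_nonneg_left (hw k) (by positivity)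
      _ = τ ^ 2 := by simp_rw [mul_one]; rw [← Finset.mul_sum, hr1, mul_one]
  · intro p
    rw [← hsum]
    simp only [Pi.smul_apply, Finset.sum_apply, smul_eq_mul]
    rw [Finset.mul_sum]
    refine Finset.sum_congr rfl fun k _ => ?_
    simp_rw [mul_assoc]
    rw [← Finset.mul_sum, ← Finset.mul_sum, relu_mul_of_nonneg hτ,
      relu_mul_of_nonneg (Real.sqrt_nonneg _), hzw]
    calc √(r k) * (a k * (τ * (√(r k) * relu (∑ j, w k j * x p j))))
        = (√(r k) * √(r k)) * (τ * (a k * relu (∑ j, w k j * x p j))) := by ring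
      _ = _ := by rw [Real.mul_self_sqrt (hr k).le]; ring

end VariationBall

/-! ### ReLU expansions of cosine ridges on a grid. -/

theorem sum_range_second_difference (g : ℕ → ℝ) (t : ℕ) :
    ∑ s ∈ range t, (g (s + 2) - 2 * g (s + 1) + g s) * ((t : ℝ) - (s + 1)) =
      g t - g 0 - (g 1 - g 0) * t := by
  have h1 : ∀ t, ∑ s ∈ range t, (g (s + 2) - 2 * g (s + 1) + g s) =
      g (t + 1) - g t - (g 1 - g 0) := fun t => by
    induction t with
    | zero => simp
    | succ t ih => rw [Finset.sum_range_succ, ih]; ring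
  induction t with
  | zero => simp
  | succ t ih =>
    have h2 : ∀ s : ℕ, (g (s + 2) - 2 * g (s + 1) + g s) * (((t + 1 : ℕ) : ℝ) - (s + 1)) =
        (g (s + 2) - 2 * g (s + 1) + g s) * ((t : ℝ) - (s + 1)) +
          (g (s + 2) - 2 * g (s + 1) + g s) := fun s => by push_cast; ring
    rw [Finset.sum_range_succ, Finset.sum_congr rfl fun s _ => h2 s, Finset.sum_add_distrib, ih, h1]
    push_cast
    ring

/-- Discrete Taylor formula: on the integers up to K, a function is its linear interpolation with
knots at integers, and the slope changes are the second differences. -/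
theorem eq_sum_relu (g : ℕ → ℝ) {t K : ℕ} (ht : t ≤ K) :
    g t = g 0 * relu 1 + (g 1 - g 0) * relu t +
      ∑ s ∈ range K, (g (s + 2) - 2 * g (s + 1) + g s) * relu ((t : ℝ) - (s + 1)) := by
  rw [relu_of_nonneg zero_le_one, relu_of_nonneg (Nat.cast_nonneg t),
    ← Finset.sum_subset (Finset.range_subset_range.2 ht)]
  · have : ∀ s ∈ range t, (g (s + 2) - 2 * g (s + 1) + g s) * relu ((t : ℝ) - (s + 1)) =
        (g (s + 2) - 2 * g (s + 1) + g s) * ((t : ℝ) - (s + 1)) := fun s hs => by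
      have : ((s + 1 : ℕ) : ℝ) ≤ t := Nat.cast_le.2 (Finset.mem_range.1 hs)
      push_cast at this
      rw [relu_of_nonneg (by linarith)]
    rw [Finset.sum_congr rfl this, sum_range_second_difference]
    ring
  · intro s _ hs
    have : (t : ℝ) ≤ s := Nat.cast_le.2 (by simpa using hs)
    rw [relu_of_nonpos (by linarith), mul_zero]

/-- The grid points `(p / (4 N), 1 / 2)`. -/
noncomputable def gridPoint (N : ℕ) (p : Fin 4 → Fin N) : Option (Fin 4) → ℝ
  | none => 1 / 2
  | some j => (p j : ℝ) / (4 * N)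

/-- The integer frequency pairing. -/
def gridPairing {N : ℕ} (ω p : Fin 4 → Fin N) : ℕ := ∑ j, (ω j : ℕ) * (p j : ℕ)

theorem gridPairing_le {N : ℕ} (ω p : Fin 4 → Fin N) : gridPairing ω p ≤ 4 * N ^ 2 := by
  calc gridPairing ω p ≤ ∑ _j : Fin 4, N * N :=
        Finset.sum_le_sum fun j _ => Nat.mul_le_mul (ω j).2.le (p j).2.le
    _ = 4 * N ^ 2 := by simp; ring

theorem gridPoint_injective {N : ℕ} (hN : 0 < N) : Function.Injective (gridPoint N) := by
  intro p q h
  funext j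
  have h1 := congrFun h (some j)
  have : (0 : ℝ) < N := Nat.cast_pos.2 hN
  simp only [gridPoint] at h1
  rw [div_left_inj' (by positivity)] at h1
  exact Fin.ext (by exact_mod_cast h1)

theorem sum_gridPoint_sq_le {N : ℕ} (hN : 0 < N) (p : Fin 4 → Fin N) :
    ∑ j, gridPoint N p j ^ 2 ≤ 1 := by
  have hN' : (0 : ℝ) < N := Nat.cast_pos.2 hN
  have h : ∀ j : Fin 4, ((p j : ℝ) / (4 * N)) ^ 2 ≤ 1 / 16 := fun j => by
    have : (p j : ℝ) / (4 * N) ≤ 1 / 4 := by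
      rw [div_le_iff₀ (by positivity)]
      have : ((p j : ℕ) : ℝ) ≤ N := Nat.cast_le.2 (p j).2.le
      linarith
    have h0 : 0 ≤ (p j : ℝ) / (4 * N) := by positivity
    nlinarith
  rw [Fintype.sum_option]
  simp only [gridPoint]
  have := Finset.sum_le_sum fun j (_ : j ∈ (univ : Finset (Fin 4))) => h j
  simp only [Finset.sum_const, Finset.card_univ, Fintype.card_fin, nsmul_eq_mul] at this
  norm_num at this ⊢
  linarith

theorem grid_neuron_mem {N : ℕ} (hN : 0 < N) (c r s : ℝ) (hr : 0 ≤ r) (hr1 : r ≤ 1)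
    (hs : |s| ≤ 4 * (N : ℝ) ^ 2) (ω : Fin 4 → Fin N) :
    (fun p => c * relu (r * (gridPairing ω p : ℝ) + s)) ∈
      (|c| * (12 * (N : ℝ) ^ 2)) • variationBall (gridPoint N) := by
  have hN' : (0 : ℝ) < N := Nat.cast_pos.2 hN
  -- The factors 2 and 4N undo the scaling of the grid coordinates; the squared norm is at most
  -- 64N^4 + 64N^4 ≤ (12N²)².
  let w : Option (Fin 4) → ℝ := fun o => o.elim (2 * s) fun j => r * (4 * N * (ω j : ℝ))
  have h := neuron_mem_smul_variationBall (gridPoint N) c w (ρ := 12 * (N : ℝ) ^ 2)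
    (by positivity) (by
      rw [Fintype.sum_option]
      simp only [w, Option.elim]
      have h1 : ∀ j : Fin 4, (r * (4 * N * (ω j : ℝ))) ^ 2 ≤ 16 * (N : ℝ) ^ 4 := fun j => by
        have h2 : ((ω j : ℕ) : ℝ) ≤ N := Nat.cast_le.2 (ω j).2.le
        calc (r * (4 * N * (ω j : ℝ))) ^ 2 ≤ (1 * (4 * N * N)) ^ 2 := by gcongr
          _ = _ := by ring
      have := Finset.sum_le_sum fun j (_ : j ∈ (univ : Finset (Fin 4))) => h1 j
      simp only [Finset.sum_const, Finset.card_univ, Fintype.card_fin, nsmul_eq_mul] at this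
      have h3 : s ^ 2 ≤ (4 * (N : ℝ) ^ 2) ^ 2 := sq_le_sq' (abs_le.1 hs).1 (abs_le.1 hs).2
      push_cast at this
      nlinarith [pow_pos hN' 4])
  convert h using 1
  ext p
  rw [Fintype.sum_option]
  simp only [w, Option.elim, gridPoint, gridPairing]
  congr 2
  push_cast
  rw [Finset.mul_sum, add_comm]
  congr 1
  · ring
  · refine Finset.sum_congr rfl fun j _ => ?_
    field_simp

theorem second_difference_cos (c θ φ : ℝ) (s : ℕ) :
    |c * Real.cos (θ * ((s + 2 : ℕ) : ℝ) + φ) - 2 * (c * Real.cos (θ * ((s + 1 : ℕ) : ℝ) + φ)) +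
      c * Real.cos (θ * (s : ℝ) + φ)| ≤ |c| * θ ^ 2 := by
  set A := θ * ((s + 1 : ℕ) : ℝ) + φ with hA
  have h1 : θ * ((s + 2 : ℕ) : ℝ) + φ = A + θ := by rw [hA]; push_cast; ring
  have h2 : θ * (s : ℝ) + φ = A - θ := by rw [hA]; push_cast; ring
  rw [h1, h2, Real.cos_add, Real.cos_sub]
  have h3 : c * (Real.cos A * Real.cos θ - Real.sin A * Real.sin θ) - 2 * (c * Real.cos A) +
      c * (Real.cos A * Real.cos θ + Real.sin A * Real.sin θ) =
      c * (Real.cos A * (2 * (Real.cos θ - 1))) := by ring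
  rw [h3, abs_mul, abs_mul]
  have h4 : |2 * (Real.cos θ - 1)| ≤ θ ^ 2 := by
    rw [abs_of_nonpos (by linarith [Real.cos_le_one θ])]
    linarith [Real.one_sub_sq_div_two_le_cos (x := θ)]
  calc |c| * (|Real.cos A| * |2 * (Real.cos θ - 1)|) ≤ |c| * (1 * θ ^ 2) := by
        gcongr
        exact Real.abs_cos_le_one A
    _ = _ := by ring

/-- The pairing takes integer values up to 4N², and each second difference is at most |c| (2π/N)²,
so their sum is at most 16π² |c|, independently of N. Only the norm 12N² of a single neuron depends
on N. -/
theorem cos_ridge_mem {N : ℕ} (hN : 0 < N) (c φ : ℝ) (ω : Fin 4 → Fin N) :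
    (fun p => c * Real.cos (2 * Real.pi / N * (gridPairing ω p : ℝ) + φ)) ∈
      (|c| * (2000 * (N : ℝ) ^ 2)) • variationBall (gridPoint N) := by
  have hN' : (1 : ℝ) ≤ N := Nat.one_le_cast.2 hN
  set θ := 2 * Real.pi / N with hθ
  let g : ℕ → ℝ := fun t => c * Real.cos (θ * t + φ)
  set K := 4 * N ^ 2 with hK
  have hg : ∀ t, |g t| ≤ |c| := fun t => by
    simp only [g, abs_mul]
    exact mul_le_of_le_one_right (abs_nonneg _) (Real.abs_cos_le_one _)
  -- A zero frequency coefficient yields the constant neuron.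
  have e1 := grid_neuron_mem hN (g 0) 0 1 le_rfl zero_le_one (by rw [abs_one]; nlinarith) ω
  have e2 := grid_neuron_mem hN (g 1 - g 0) 1 0 zero_le_one le_rfl (by rw [abs_zero]; positivity) ω
  have e3 := sum_mem_smul_variationBall (gridPoint N) (range K)
    (fun s p => (g (s + 2) - 2 * g (s + 1) + g s) * relu (1 * (gridPairing ω p : ℝ) + -((s : ℝ) + 1)))
    (fun s => |g (s + 2) - 2 * g (s + 1) + g s| * (12 * (N : ℝ) ^ 2)) (fun s _ => by positivity)
    (fun s hs => grid_neuron_mem hN _ 1 _ zero_le_one le_rfl (by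
      rw [abs_neg, abs_of_nonneg (by positivity)]
      have : ((s + 1 : ℕ) : ℝ) ≤ K := Nat.cast_le.2 (Finset.mem_range.1 hs)
      rw [hK] at this
      push_cast at this
      linarith) ω)
  have e := add_mem_smul_variationBall _ (by positivity)
    (Finset.sum_nonneg fun s _ => by positivity)
    (add_mem_smul_variationBall _ (by positivity) (by positivity) e1 e2) e3
  have hsum : ∑ s ∈ range K, |g (s + 2) - 2 * g (s + 1) + g s| ≤ 160 * |c| := by
    calc ∑ s ∈ range K, |g (s + 2) - 2 * g (s + 1) + g s| ≤ ∑ _s ∈ range K, |c| * θ ^ 2 :=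
          Finset.sum_le_sum fun s _ => second_difference_cos c θ φ s
      _ = |c| * (16 * Real.pi ^ 2) := by
          rw [Finset.sum_const, Finset.card_range, nsmul_eq_mul, hK, hθ]
          push_cast
          field_simp
          ring
      _ ≤ 160 * |c| := by
          have : Real.pi ^ 2 ≤ 10 := by nlinarith [Real.pi_pos, Real.pi_lt_d2]
          nlinarith [abs_nonneg c]
  convert mem_smul_variationBall_mono _ ?_ ?_ e using 1
  · ext p
    have := eq_sum_relu g (gridPairing_le ω p)
    simp only [g] at this
    rw [this]
    simp [g, sub_eq_add_neg, hK]
  · exact add_nonneg (by positivity) (Finset.sum_nonneg fun s _ => by positivity)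
  · rw [← Finset.sum_mul]
    have h1 : |g 1 - g 0| ≤ 2 * |c| := (abs_sub _ _).trans (by linarith [hg 0, hg 1])
    have : |g 0| + |g 1 - g 0| + ∑ s ∈ range K, |g (s + 2) - 2 * g (s + 1) + g s| ≤ 163 * |c| := by
      linarith [hg 0]
    nlinarith [sq_nonneg (N : ℝ), abs_nonneg c, mul_le_mul_of_nonneg_right this (sq_nonneg (N : ℝ)),
      mul_nonneg (abs_nonneg c) (sq_nonneg (N : ℝ))]

/-! ### Discrete Fourier analysis of the labels. -/

theorem exp_two_pi_ne_one {N : ℕ} {a b : Fin N} (h : a ≠ b) :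
    Complex.exp (((2 * Real.pi / N * ((a : ℝ) - b) : ℝ) : ℂ) * Complex.I) ≠ 1 := by
  intro h1
  obtain ⟨n, hn⟩ := Complex.exp_eq_one_iff.1 h1
  have hN : (0 : ℝ) < N := Nat.cast_pos.2 a.pos
  have h2 : 2 * Real.pi / N * ((a : ℝ) - b) = n * (2 * Real.pi) := by
    have h3 : (((2 * Real.pi / N * ((a : ℝ) - b) : ℝ) : ℂ)) = ((n * (2 * Real.pi) : ℝ) : ℂ) := by
      apply mul_right_cancel₀ Complex.I_ne_zero
      rw [hn]
      push_cast
      ring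
    exact_mod_cast h3
  have h4 : ((a : ℕ) : ℝ) - (b : ℕ) = n * N := by
    have := Real.pi_pos
    field_simp at h2
    linarith
  have h5 : ((a : ℕ) : ℤ) - (b : ℕ) = n * N := by exact_mod_cast h4
  have ha := a.2
  have hb := b.2
  have h6 : n = 0 := by
    by_contra hne
    rcases lt_or_gt_of_ne hne with h | h
    · have : n * (N : ℤ) ≤ -1 * N := mul_le_mul_of_nonneg_right (by omega) (by omega)
      omega
    · have : 1 * (N : ℤ) ≤ n * N := mul_le_mul_of_nonneg_right (by omega) (by omega)
      omega
  rw [h6] at h5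
  exact h (Fin.ext (by omega))

theorem sum_exp_pow {N : ℕ} (a b : Fin N) :
    ∑ t : Fin N, Complex.exp (((2 * Real.pi / N * ((a : ℝ) - b) : ℝ) : ℂ) * Complex.I) ^ (t : ℕ) =
      if a = b then (N : ℂ) else 0 := by
  split_ifs with h
  · subst h; simp
  · rw [Fin.sum_univ_eq_sum_range (fun t => Complex.exp
      (((2 * Real.pi / N * ((a : ℝ) - b) : ℝ) : ℂ) * Complex.I) ^ t) N,
      geom_sum_eq (exp_two_pi_ne_one h), ← Complex.exp_nat_mul]
    have hN : (N : ℂ) ≠ 0 := Nat.cast_ne_zero.2 a.pos.ne'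
    have : (N : ℂ) * (((2 * Real.pi / N * ((a : ℝ) - b) : ℝ) : ℂ) * Complex.I) =
        ((((a : ℕ) : ℤ) - ((b : ℕ) : ℤ) : ℤ) : ℂ) * (2 * Real.pi * Complex.I) := by
      push_cast
      field_simp
    rw [this, Complex.exp_int_mul_two_pi_mul_I]
    simp

/-- Orthogonality of characters of (ℤ/N)^4: the exponential sum factors over coordinates into
geometric sums. -/
theorem sum_cos_gridPairing {N : ℕ} (p q : Fin 4 → Fin N) :
    ∑ ω : Fin 4 → Fin N, Real.cos (2 * Real.pi / N * (gridPairing ω p : ℝ) -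
      2 * Real.pi / N * (gridPairing ω q : ℝ)) = if p = q then (N : ℝ) ^ 4 else 0 := by
  have h1 : ∀ ω : Fin 4 → Fin N, Complex.exp (((2 * Real.pi / N * (gridPairing ω p : ℝ) -
      2 * Real.pi / N * (gridPairing ω q : ℝ) : ℝ) : ℂ) * Complex.I) =
      ∏ j, Complex.exp (((2 * Real.pi / N * ((p j : ℝ) - q j) : ℝ) : ℂ) * Complex.I) ^ (ω j : ℕ) := by
    intro ω
    simp_rw [← Complex.exp_nat_mul]
    rw [← Complex.exp_sum]
    congr 1
    simp only [gridPairing]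
    push_cast
    rw [Finset.mul_sum, Finset.mul_sum, ← Finset.sum_sub_distrib, Finset.sum_mul]
    refine Finset.sum_congr rfl fun j _ => ?_
    ring
  have h2 : ∑ ω : Fin 4 → Fin N, Complex.exp (((2 * Real.pi / N * (gridPairing ω p : ℝ) -
      2 * Real.pi / N * (gridPairing ω q : ℝ) : ℝ) : ℂ) * Complex.I) =
      if p = q then (N : ℂ) ^ 4 else 0 := by
    simp_rw [h1]
    have h3 := Finset.prod_univ_sum (fun _ : Fin 4 => (univ : Finset (Fin N))) (fun j t =>
      Complex.exp (((2 * Real.pi / N * ((p j : ℝ) - q j) : ℝ) : ℂ) * Complex.I) ^ (t : ℕ))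
    rw [Fintype.piFinset_univ] at h3
    rw [← h3]
    simp_rw [sum_exp_pow]
    split_ifs with h
    · subst h; simp
    · obtain ⟨j, hj⟩ := Function.ne_iff.1 h
      exact Finset.prod_eq_zero (Finset.mem_univ j) (if_neg hj)
  have h3 := congrArg Complex.re h2
  rw [Complex.re_sum] at h3
  simp_rw [Complex.exp_ofReal_mul_I_re] at h3
  rw [h3]
  split_ifs
  · rw [← Complex.ofReal_natCast, ← Complex.ofReal_pow, Complex.ofReal_re]
  · simp

/-- Parseval gives the Fourier coefficients ℓ² norm 1; Cauchy–Schwarz over N^4 frequencies bounds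
their ℓ¹ norm by √2 N² ≤ (3/2) N², and each ridge costs 2000 N². -/
theorem labels_mem_smul_variationBall {N : ℕ} (hN : 0 < N) (y : (Fin 4 → Fin N) → ℝ)
    (hy : ∀ p, y p ^ 2 = 1) : y ∈ (3000 * (N : ℝ) ^ 4) • variationBall (gridPoint N) := by
  have hN' : (0 : ℝ) < N := Nat.cast_pos.2 hN
  set θ := 2 * Real.pi / N with hθ
  let α : (Fin 4 → Fin N) → ℝ := fun ω => ((N : ℝ) ^ 4)⁻¹ * ∑ q, y q * Real.cos (θ * gridPairing ω q)
  let β : (Fin 4 → Fin N) → ℝ := fun ω => ((N : ℝ) ^ 4)⁻¹ * ∑ q, y q * Real.sin (θ * gridPairing ω q)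
  have hinv : ∀ p, ∑ ω, (α ω * Real.cos (θ * gridPairing ω p) + β ω * Real.sin (θ * gridPairing ω p)) =
      y p := by
    intro p
    have h1 : ∀ ω, α ω * Real.cos (θ * gridPairing ω p) + β ω * Real.sin (θ * gridPairing ω p) =
        ∑ q, ((N : ℝ) ^ 4)⁻¹ * y q * Real.cos (θ * gridPairing ω p - θ * gridPairing ω q) := by
      intro ω
      simp only [α, β]
      rw [Finset.mul_sum, Finset.mul_sum, Finset.sum_mul, Finset.sum_mul, ← Finset.sum_add_distrib]
      refine Finset.sum_congr rfl fun q _ => ?_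
      rw [Real.cos_sub]
      ring
    simp_rw [h1]
    rw [Finset.sum_comm]
    simp_rw [← Finset.mul_sum, hθ, sum_cos_gridPairing]
    simp
    field_simp
  have hpar : ∑ ω, (α ω ^ 2 + β ω ^ 2) = 1 := by
    have h1 : ∀ ω, α ω ^ 2 + β ω ^ 2 = ∑ q, ((N : ℝ) ^ 4)⁻¹ * y q *
        (α ω * Real.cos (θ * gridPairing ω q) + β ω * Real.sin (θ * gridPairing ω q)) := by
      intro ω
      have e1 : α ω ^ 2 = ∑ q, ((N : ℝ) ^ 4)⁻¹ * y q * (α ω * Real.cos (θ * gridPairing ω q)) := by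
        rw [sq]
        nth_rw 2 [show α ω = ((N : ℝ) ^ 4)⁻¹ * ∑ q, y q * Real.cos (θ * gridPairing ω q) from rfl]
        rw [Finset.mul_sum, Finset.mul_sum]
        exact Finset.sum_congr rfl fun q _ => by ring
      have e2 : β ω ^ 2 = ∑ q, ((N : ℝ) ^ 4)⁻¹ * y q * (β ω * Real.sin (θ * gridPairing ω q)) := by
        rw [sq]
        nth_rw 2 [show β ω = ((N : ℝ) ^ 4)⁻¹ * ∑ q, y q * Real.sin (θ * gridPairing ω q) from rfl]
        rw [Finset.mul_sum, Finset.mul_sum]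
        exact Finset.sum_congr rfl fun q _ => by ring
      rw [e1, e2, ← Finset.sum_add_distrib]
      exact Finset.sum_congr rfl fun q _ => by ring
    simp_rw [h1]
    rw [Finset.sum_comm]
    simp_rw [← Finset.mul_sum, hinv, mul_assoc, ← sq, hy]
    simp
    field_simp
  have hsum : ∑ ω, (|α ω| + |β ω|) ≤ 3 / 2 * (N : ℝ) ^ 2 := by
    apply abs_le_of_sq_le_sq' _ (by positivity) |>.2
    calc (∑ ω, (|α ω| + |β ω|)) ^ 2 ≤ (univ : Finset (Fin 4 → Fin N)).card *
          ∑ ω, (|α ω| + |β ω|) ^ 2 := sq_sum_le_card_mul_sum_sq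
      _ ≤ (univ : Finset (Fin 4 → Fin N)).card * ∑ ω, 2 * (α ω ^ 2 + β ω ^ 2) := by
          gcongr with ω
          nlinarith [sq_abs (α ω), sq_abs (β ω), sq_nonneg (|α ω| - |β ω|)]
      _ = 2 * (N : ℝ) ^ 4 := by
          rw [← Finset.mul_sum, hpar]
          simp
          ring
      _ ≤ (3 / 2 * (N : ℝ) ^ 2) ^ 2 := by nlinarith [pow_pos hN' 4]
  have hmem := sum_mem_smul_variationBall (gridPoint N) univ
    (fun ω p => α ω * Real.cos (θ * gridPairing ω p) + β ω * Real.sin (θ * gridPairing ω p))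
    (fun ω => |α ω| * (2000 * (N : ℝ) ^ 2) + |β ω| * (2000 * (N : ℝ) ^ 2))
    (fun ω _ => by positivity) (fun ω _ => by
      have e1 := cos_ridge_mem hN (α ω) 0 ω
      have e2 := cos_ridge_mem hN (β ω) (-(Real.pi / 2)) ω
      simp_rw [← sub_eq_add_neg, Real.cos_sub_pi_div_two] at e2
      simp_rw [add_zero] at e1
      exact add_mem_smul_variationBall _ (by positivity) (by positivity) e1 e2)
  convert mem_smul_variationBall_mono _ ?_ ?_ hmem using 1
  · ext p
    rw [Finset.sum_apply, hinv]
  · exact Finset.sum_nonneg fun ω _ => by positivity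
  · simp_rw [← add_mul]
    rw [← Finset.sum_mul]
    calc _ ≤ 3 / 2 * (N : ℝ) ^ 2 * (2000 * (N : ℝ) ^ 2) := by gcongr
      _ = _ := by ring

/-- In dimension at least five, ReLU networks shatter `N ^ 4` points as soon as the width and
`b B b_x / ε` exceed a constant multiple of `N ^ 4`. -/
theorem canShatterAtLeast_grid {N n d : ℕ} {b B bx ε : ℝ} (hN : 0 < N) (hd : 5 ≤ d)
    (hb : 0 < b) (hB : 0 < B) (hbx : 0 < bx) (hε : 0 < ε) (hn : N ^ 4 + 1 ≤ n)
    (hT : 3000 * (N : ℝ) ^ 4 ≤ b * B * bx / ε) :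
    CanShatterAtLeast (frobeniusClass relu b B n d) {x | ‖x‖ ≤ bx} ((N : ℝ) ^ 4) ε := by
  have hcard : Fintype.card (Fin 4 → Fin N) = N ^ 4 := by simp
  have h := canShatterAtLeast_of_networks (gridPoint N) (gridPoint_injective hN)
    (sum_gridPoint_sq_le hN) (n := n) (d := d) hb hB hbx hε (by simpa using hd) 0 (fun y => by
      obtain ⟨κ, hκ, u, w, h1, h2, h3, h4⟩ := exists_network_of_mem_smul_variationBall _
        (by positivity) (labels_mem_smul_variationBall hN (fun p => if y p = 0 then -1 else 1)
          (fun p => by split_ifs <;> norm_num))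
      refine ⟨κ, hκ, u, w, 1, _, by omega, one_pos, h2, h3, ?_, fun p => ?_⟩
      · rw [one_mul]
        gcongr
      · rw [h4]
        constructor <;> intro hy <;> simp [hy])
  rw [hcard] at h
  exact_mod_cast h

/-! ### Random colourings and incoherent vectors. -/

/-- Moment generating function of a centred Bernoulli(1/n) variable. Since e^s ≤ 1 + s + s² for |s|
≤ 1, centring cancels the linear term; the variance factor 1/n is kept. -/
theorem sum_exp_indicator_le {n : ℕ} (hn : 0 < n) (k : Fin n) {s : ℝ} (hs : |s| ≤ 1) :
    ∑ k' : Fin n, Real.exp (s * ((if k' = k then 1 else 0) - 1 / (n : ℝ))) ≤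
      n * Real.exp (s ^ 2 / n) := by
  have hn' : (0 : ℝ) < n := Nat.cast_pos.2 hn
  have h1 : ∀ k' : Fin n, Real.exp (s * ((if k' = k then 1 else 0) - 1 / (n : ℝ))) =
      Real.exp (-(s / n)) * (1 + if k' = k then Real.exp s - 1 else 0) := by
    intro k'
    split_ifs
    · rw [show s * (1 - 1 / (n : ℝ)) = -(s / n) + s by ring, Real.exp_add]
      ring
    · rw [show s * (0 - 1 / (n : ℝ)) = -(s / n) by ring]
      ring
  simp_rw [h1]
  rw [← Finset.mul_sum, Finset.sum_add_distrib, Finset.sum_ite_eq' univ k]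
  simp only [Finset.sum_const, Finset.card_univ, Fintype.card_fin, Finset.mem_univ, if_true,
    nsmul_eq_mul, mul_one]
  have h2 : Real.exp s - 1 ≤ s + s ^ 2 := by
    have := (abs_le.1 (Real.abs_exp_sub_one_sub_id_le hs)).2
    linarith
  calc Real.exp (-(s / n)) * (n + (Real.exp s - 1))
      ≤ Real.exp (-(s / n)) * (n + (s + s ^ 2)) := by gcongr
    _ = Real.exp (-(s / n)) * (n * ((s + s ^ 2) / n + 1)) := by field_simp; ring
    _ ≤ Real.exp (-(s / n)) * (n * Real.exp ((s + s ^ 2) / n)) := by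
        gcongr
        exact Real.add_one_le_exp _
    _ = n * Real.exp (s ^ 2 / n) := by
        rw [mul_left_comm, ← Real.exp_add]
        congr 2
        ring

/-- Colours of distinct points are independent, so the sum over colourings is a product. -/
theorem sum_exp_coloring_le {m n : ℕ} (hn : 0 < n) (k : Fin n) (a : Fin m → ℝ) {α t : ℝ}
    (ha : ∀ i, |a i| ≤ α) (htα : |t| * α ≤ 1) :
    ∑ κ : Fin m → Fin n, Real.exp (t * ∑ i, ((if κ i = k then 1 else 0) - 1 / (n : ℝ)) * a i) ≤
      n ^ m * Real.exp (t ^ 2 * (m * α ^ 2 / n)) := by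
  have h1 : ∀ κ : Fin m → Fin n,
      Real.exp (t * ∑ i, ((if κ i = k then 1 else 0) - 1 / (n : ℝ)) * a i) =
      ∏ i, Real.exp (t * a i * ((if κ i = k then 1 else 0) - 1 / (n : ℝ))) := fun κ => by
    rw [← Real.exp_sum, Finset.mul_sum]
    congr 1
    exact Finset.sum_congr rfl fun i _ => by ring
  simp_rw [h1]
  have h2 := Finset.prod_univ_sum (fun _ : Fin m => (univ : Finset (Fin n)))
    (fun i k' => Real.exp (t * a i * ((if k' = k then 1 else 0) - 1 / (n : ℝ))))
  rw [Fintype.piFinset_univ] at h2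
  rw [← h2]
  have h3 : ∀ i, |t * a i| ≤ |t| * α := fun i => by
    rw [abs_mul]
    exact mul_le_mul_of_nonneg_left (ha i) (abs_nonneg t)
  calc _ ≤ ∏ _i : Fin m, (n * Real.exp (t ^ 2 * α ^ 2 / n)) := by
        refine Finset.prod_le_prod (fun i _ => Finset.sum_nonneg fun _ _ => (Real.exp_pos _).le)
          fun i _ => (sum_exp_indicator_le hn k ((h3 i).trans htα)).trans ?_
        have : (t * a i) ^ 2 ≤ t ^ 2 * α ^ 2 := by
          rw [← sq_abs (t * a i), ← sq_abs t, ← mul_pow]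
          exact pow_le_pow_left₀ (abs_nonneg _) (h3 i) 2
        gcongr
    _ = n ^ m * Real.exp (t ^ 2 * (m * α ^ 2 / n)) := by
        rw [Finset.prod_const, mul_pow, ← Real.exp_nat_mul]
        simp only [Finset.card_univ, Fintype.card_fin]
        congr 2
        ring

/-- A Chernoff bound with a union bound: some colouring with `n` colours balances all the bounded
weight vectors `A j` simultaneously. -/
theorem exists_balanced_coloring {J : Type*} [Fintype J] {m n : ℕ} (hn : 0 < n)
    (A : J → Fin m → ℝ) {α t L δ : ℝ} (ht : 0 < t) (hA : ∀ j i, |A j i| ≤ α) (htα : t * α ≤ 1)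
    (hvar : t ^ 2 * (m * α ^ 2 / n) ≤ L) (htail : 2 * L ≤ t * δ)
    (hcard : 2 * n * (Fintype.card J : ℝ) < Real.exp L) :
    ∃ κ : Fin m → Fin n, ∀ j k,
      |∑ i, ((if κ i = k then 1 else 0) - 1 / (n : ℝ)) * A j i| ≤ δ := by
  by_contra! hcon
  let X : (Fin m → Fin n) → J → Fin n → ℝ := fun κ j k =>
    ∑ i, ((if κ i = k then 1 else 0) - 1 / (n : ℝ)) * A j i
  -- If every colouring were bad, the exponential sum would be at least e^(2L) for each, while its
  -- average over colourings is at most 2n|J| e^L < e^(2L).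
  have hlow : ∀ κ, Real.exp (2 * L) ≤
      ∑ j, ∑ k, (Real.exp (t * X κ j k) + Real.exp (-t * X κ j k)) := by
    intro κ
    obtain ⟨j, k, h⟩ := hcon κ
    have h1 : Real.exp (2 * L) ≤ Real.exp (t * X κ j k) + Real.exp (-t * X κ j k) := by
      rcases lt_abs.1 h with h | h
      · have : Real.exp (2 * L) ≤ Real.exp (t * X κ j k) :=
          Real.exp_le_exp.2 (htail.trans (mul_le_mul_of_nonneg_left h.le ht.le))
        linarith [Real.exp_pos (-t * X κ j k)]
      · have : Real.exp (2 * L) ≤ Real.exp (-t * X κ j k) := by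
          refine Real.exp_le_exp.2 (htail.trans ?_)
          rw [neg_mul, ← mul_neg]
          exact mul_le_mul_of_nonneg_left h.le ht.le
        linarith [Real.exp_pos (t * X κ j k)]
    refine h1.trans ?_
    refine le_trans ?_ (Finset.single_le_sum (f := fun j => ∑ k, (Real.exp (t * X κ j k) +
      Real.exp (-t * X κ j k))) (fun j _ => Finset.sum_nonneg fun k _ => by positivity)
      (Finset.mem_univ j))
    exact Finset.single_le_sum (f := fun k => Real.exp (t * X κ j k) + Real.exp (-t * X κ j k))
      (fun k _ => by positivity) (Finset.mem_univ k)
  have hup : ∀ j k, ∑ κ, (Real.exp (t * X κ j k) + Real.exp (-t * X κ j k)) ≤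
      2 * (n ^ m * Real.exp L) := by
    intro j k
    rw [Finset.sum_add_distrib]
    have e1 := sum_exp_coloring_le hn k (A j) (hA j) (t := t) (by rwa [abs_of_pos ht])
    have e2 := sum_exp_coloring_le hn k (A j) (hA j) (t := -t) (by rwa [abs_neg, abs_of_pos ht])
    rw [neg_sq] at e2
    have e3 : (n : ℝ) ^ m * Real.exp (t ^ 2 * (m * α ^ 2 / n)) ≤ n ^ m * Real.exp L := by gcongr
    linarith
  have h1 : (n : ℝ) ^ m * Real.exp (2 * L) ≤
      (Fintype.card J : ℝ) * (n * (2 * (n ^ m * Real.exp L))) := by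
    calc (n : ℝ) ^ m * Real.exp (2 * L) = ∑ _κ : Fin m → Fin n, Real.exp (2 * L) := by simp
      _ ≤ ∑ κ, ∑ j, ∑ k, (Real.exp (t * X κ j k) + Real.exp (-t * X κ j k)) :=
          Finset.sum_le_sum fun κ _ => hlow κ
      _ = ∑ j, ∑ k, ∑ κ, (Real.exp (t * X κ j k) + Real.exp (-t * X κ j k)) := by
          rw [Finset.sum_comm]
          exact Finset.sum_congr rfl fun j _ => Finset.sum_comm
      _ ≤ ∑ _j : J, ∑ _k : Fin n, 2 * (n ^ m * Real.exp L) :=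
          Finset.sum_le_sum fun j _ => Finset.sum_le_sum fun k _ => hup j k
      _ = _ := by simp
  have hpos : 0 < (n : ℝ) ^ m * Real.exp L := by positivity
  rw [two_mul L, Real.exp_add] at h1
  have : (n : ℝ) ^ m * Real.exp L * Real.exp L ≤
      (n : ℝ) ^ m * Real.exp L * (2 * n * (Fintype.card J : ℝ)) := by linarith
  exact absurd (le_of_mul_le_mul_left this hpos) (not_le.2 hcard)

/-- Reed–Solomon codewords give `q ^ r` unit vectors of dimension `q ^ 2` and coherence `r / q`. -/
theorem exists_incoherent_vectors (q r m : ℕ) [hq : Fact q.Prime] (hm : m ≤ q ^ r) :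
    ∃ z : Fin m → ZMod q × ZMod q → ℝ, (∀ i, ∑ a, z i a ^ 2 = 1) ∧
      ∀ i j, i ≠ j → |∑ a, z i a * z j a| ≤ (r : ℝ) / q := by
  classical
  obtain ⟨e⟩ := Function.Embedding.nonempty_of_card_le (α := Fin m) (β := Fin r → ZMod q)
    (by simpa [ZMod.card] using hm)
  let f : Fin m → Polynomial.degreeLT (ZMod q) r := fun i =>
    (Polynomial.degreeLTEquiv (ZMod q) r).symm (e i)
  have hf : Function.Injective f := (LinearEquiv.injective _).comp e.injective
  have hq0 : (0 : ℝ) < q := Nat.cast_pos.2 hq.out.pos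
  let v : ℝ := √(q : ℝ)⁻¹
  have hv : v * v = (q : ℝ)⁻¹ := Real.mul_self_sqrt (by positivity)
  let z : Fin m → ZMod q × ZMod q → ℝ := fun i a => if (f i : Polynomial _).eval a.1 = a.2 then v else 0
  have hinner : ∀ i j, ∑ a, z i a * z j a =
      (#{x | (f i : Polynomial (ZMod q)).eval x = (f j : Polynomial (ZMod q)).eval x} : ℝ) / q := by
    intro i j
    rw [Fintype.sum_prod_type]
    have : ∀ x : ZMod q, ∑ y, z i (x, y) * z j (x, y) =
        if (f i : Polynomial (ZMod q)).eval x = (f j : Polynomial (ZMod q)).eval x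
          then (q : ℝ)⁻¹ else 0 := by
      intro x
      rw [Finset.sum_eq_single ((f i : Polynomial (ZMod q)).eval x)]
      · by_cases h : (f i : Polynomial (ZMod q)).eval x = (f j : Polynomial (ZMod q)).eval x
        · simp [z, h, hv]
        · simp [z, h, Ne.symm h]
      · intro y _ hy
        simp [z, Ne.symm hy]
      · simp
    simp_rw [this]
    rw [← Finset.sum_filter, Finset.sum_const, nsmul_eq_mul, div_eq_mul_inv]
  refine ⟨z, fun i => ?_, fun i j hij => ?_⟩
  · simp_rw [sq]
    rw [hinner]
    simp [ZMod.card, hq0.ne']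
  · rw [hinner, abs_of_nonneg (by positivity)]
    gcongr
    by_contra! hlt
    apply hij
    apply hf
    apply Subtype.ext
    refine Polynomial.eq_of_degree_sub_lt_of_eval_finset_eq
      {x | (f i : Polynomial (ZMod q)).eval x = (f j : Polynomial (ZMod q)).eval x} ?_
      fun x hx => (Finset.mem_filter.1 hx).2
    have h1 : ((f i : Polynomial (ZMod q)) - f j) ∈ Polynomial.degreeLT (ZMod q) r :=
      Submodule.sub_mem _ (f i).2 (f j).2
    exact (Polynomial.mem_degreeLT.1 h1).trans (by exact_mod_cast hlt)

/-- The network for one labelling: each neuron carries the positive points of one colour, centred by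
the average over colours. -/
theorem exists_coloring_network {ι : Type} [Fintype ι] {m n : ℕ} (hn : 8 ≤ n) (z : Fin m → ι → ℝ)
    (hz1 : ∀ i, ∑ a, z i a ^ 2 = 1) (P : Fin m → Prop) [DecidablePred P] (κ : Fin m → Fin n)
    (hκ : ∀ j k, |∑ i, ((if κ i = k then 1 else 0) - 1 / (n : ℝ)) *
      (if P i ∧ i ≠ j then ∑ a, z i a * z j a else 0)| ≤ 1 / 8) :
    ∃ w : Fin n → ι → ℝ, ∑ k, ∑ a, w k a ^ 2 ≤ 9 / 4 * m ∧
      (∀ j, P j → 3 / 4 ≤ ∑ a, w (κ j) a * z j a) ∧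
      ∀ j, ¬ P j → ∀ k, ∑ a, w k a * z j a ≤ 1 / 8 := by
  classical
  have hn' : (8 : ℝ) ≤ n := by exact_mod_cast hn
  have hinv : 1 / (n : ℝ) ≤ 1 / 8 := one_div_le_one_div_of_le (by norm_num) hn'
  have hinv0 : 0 < 1 / (n : ℝ) := by positivity
  let ξ : Fin m → Fin n → ℝ := fun i k => (if κ i = k then 1 else 0) - 1 / (n : ℝ)
  -- Without the `-1/n` in `ξ`, the cross terms would have mean (1/n) ∑ ⟨z i, z j⟩ over random
  -- colours, which need not be small.
  let w : Fin n → ι → ℝ := fun k a => ∑ i, if P i then ξ i k * z i a else 0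
  let X : Fin m → Fin n → ℝ := fun j k => ∑ i, ξ i k *
      (if P i ∧ i ≠ j then ∑ a, z i a * z j a else 0)
  have hX : ∀ j k, |X j k| ≤ 1 / 8 := hκ
  have hξ : ∀ i k, |ξ i k| ≤ (if κ i = k then 1 else 0) + 1 / (n : ℝ) := by
    intro i k
    simp only [ξ]
    split_ifs
    · rw [abs_le]; constructor <;> linarith
    · rw [abs_le]; constructor <;> linarith
  have hξ1 : ∀ i k, |ξ i k| ≤ 1 := by
    intro i k
    simp only [ξ]
    split_ifs
    · rw [abs_le]; constructor <;> linarith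
    · rw [abs_le]; constructor <;> linarith
  have hwz : ∀ j k, ∑ a, w k a * z j a = X j k + if P j then ξ j k else 0 := by
    intro j k
    have h1 : ∑ a, w k a * z j a = ∑ i, ξ i k * (if P i then ∑ a, z i a * z j a else 0) := by
      simp only [w]
      simp_rw [Finset.sum_mul]
      rw [Finset.sum_comm]
      refine Finset.sum_congr rfl fun i _ => ?_
      split_ifs
      · rw [Finset.mul_sum]
        exact Finset.sum_congr rfl fun a _ => by ring
      · simp
    have h2 : ∀ i, ξ i k * (if P i then ∑ a, z i a * z j a else 0) =
        ξ i k * (if P i ∧ i ≠ j then ∑ a, z i a * z j a else 0) +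
          if i = j then (if P j then ξ j k else 0) else 0 := by
      intro i
      by_cases hij : i = j
      · subst hij
        have : ∑ a, z i a * z i a = 1 := by simp_rw [← sq]; exact hz1 i
        by_cases hP : P i <;> simp [hP, this]
      · simp [hij]
    rw [h1, Finset.sum_congr rfl fun i _ => h2 i, Finset.sum_add_distrib,
      Finset.sum_ite_eq' univ j]
    simp [X]
  have hwz_abs : ∀ j k, |∑ a, w k a * z j a| ≤ 9 / 8 := by
    intro j k
    rw [hwz]
    have h1 : |if P j then ξ j k else 0| ≤ 1 := by
      split_ifs
      · exact hξ1 j k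
      · simp
    linarith [abs_add_le (X j k) (if P j then ξ j k else 0), hX j k]
  refine ⟨w, ?_, fun j hj => ?_, fun j hj k => ?_⟩
  -- Expanding one factor, ‖w k‖² is a sum of `ξ i k` ⟨w k, z i⟩ with inner products at most 9/8;
  -- summing the bound on |ξ i k| over k gives 2 per point.
  · have h1 : ∀ k, ∑ a, w k a ^ 2 ≤ ∑ i, ((if κ i = k then 1 else 0) + 1 / (n : ℝ)) * (9 / 8) := by
      intro k
      have : ∑ a, w k a ^ 2 = ∑ i, if P i then ξ i k * ∑ a, w k a * z i a else 0 := by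
        calc ∑ a, w k a ^ 2 = ∑ a, ∑ i, (if P i then ξ i k * z i a else 0) * w k a := by
              refine Finset.sum_congr rfl fun a _ => ?_
              rw [sq, ← Finset.sum_mul]
          _ = _ := by
              rw [Finset.sum_comm]
              refine Finset.sum_congr rfl fun i _ => ?_
              split_ifs
              · rw [Finset.mul_sum]
                exact Finset.sum_congr rfl fun a _ => by ring
              · simp
      rw [this]
      refine Finset.sum_le_sum fun i _ => ?_
      have hnn : 0 ≤ (if κ i = k then (1 : ℝ) else 0) := by split_ifs <;> norm_num
      by_cases hP : P i
      · rw [if_pos hP]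
        refine (le_abs_self _).trans ?_
        rw [abs_mul]
        exact mul_le_mul (hξ i k) (hwz_abs i k) (abs_nonneg _) (by positivity)
      · rw [if_neg hP]
        positivity
    calc ∑ k, ∑ a, w k a ^ 2 ≤ ∑ k, ∑ i, ((if κ i = k then 1 else 0) + 1 / (n : ℝ)) * (9 / 8) :=
          Finset.sum_le_sum fun k _ => h1 k
      _ = ∑ i : Fin m, ∑ k, ((if κ i = k then 1 else 0) + 1 / (n : ℝ)) * (9 / 8) := Finset.sum_comm
      _ = ∑ _i : Fin m, (9 / 4 : ℝ) := by
          refine Finset.sum_congr rfl fun i _ => ?_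
          rw [← Finset.sum_mul, Finset.sum_add_distrib, Finset.sum_ite_eq univ (κ i)]
          simp only [Finset.mem_univ, if_true, Finset.sum_const, Finset.card_univ, Fintype.card_fin,
            nsmul_eq_mul]
          field_simp
          ring
      _ = _ := by simp; ring
  · rw [hwz, if_pos hj]
    have := (abs_le.1 (hX j (κ j))).1
    simp only [ξ, if_true]
    linarith
  · rw [hwz, if_neg hj, add_zero]
    exact (abs_le.1 (hX j k)).2

/-- Incoherent unit vectors are shattered by ReLU networks, using one extra coordinate as bias. -/
theorem canShatterAtLeast_incoherent {ι : Type} [Fintype ι] {m n₀ n d : ℕ} {b B bx ε α t L : ℝ}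
    (hb : 0 < b) (hB : 0 < B) (hbx : 0 < bx) (hε : 0 < ε) (hd : Fintype.card ι + 1 ≤ d)
    (hn₀ : 8 ≤ n₀) (hn : n₀ ≤ n) (z : Fin m → ι → ℝ) (hz1 : ∀ i, ∑ a, z i a ^ 2 = 1)
    (hz : ∀ i j, i ≠ j → |∑ a, z i a * z j a| ≤ α) (hα0 : 0 ≤ α) (hα : α < 1) (ht : 0 < t)
    (htα : t * α ≤ 1) (hvar : t ^ 2 * (m * α ^ 2 / n₀) ≤ L) (htail : 2 * L ≤ t * (1 / 8))
    (hcard : 2 * n₀ * (m : ℝ) < Real.exp L)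
    (hT : (n₀ : ℝ) * (64 * n₀ + 576 * m) ≤ (b * B * bx / ε) ^ 2) :
    CanShatterAtLeast (frobeniusClass relu b B n d) {x | ‖x‖ ≤ bx} m ε := by
  classical
  have hn₀' : (0 : ℝ) < n₀ := by
    have : (8 : ℝ) ≤ n₀ := by exact_mod_cast hn₀
    linarith
  let x : Fin m → Option ι → ℝ := fun i o => o.elim (1 / 2) fun a => z i a / 2
  have hx : Function.Injective x := by
    intro i j hij
    by_contra hne
    have h1 : ∀ a, z i a = z j a := fun a => by
      have := congrFun hij (some a)
      simp only [x, Option.elim] at this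
      linarith
    have h2 := hz i j hne
    simp_rw [h1, ← sq, hz1] at h2
    rw [abs_one] at h2
    linarith
  have h := canShatterAtLeast_of_networks x hx (n := n) (d := d) (fun i => by
      rw [Fintype.sum_option]
      simp only [x, Option.elim, div_pow]
      rw [← Finset.sum_div, hz1]
      norm_num) hb hB hbx hε (by simpa using hd) 1 (fun y => by
    obtain ⟨κ, hκ⟩ := exists_balanced_coloring (by omega : 0 < n₀)
      (fun j i => if y i = 1 ∧ i ≠ j then ∑ a, z i a * z j a else 0) (α := α) (δ := 1 / 8) ht
      (fun j i => by
        split_ifs with hij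
        · exact hz i j hij.2
        · simpa using hα0) htα hvar htail (by simpa using hcard)
    obtain ⟨w, hw, hpos, hneg⟩ := exists_coloring_network hn₀ z hz1 (fun i => y i = 1) κ hκ
    -- Each neuron computes 8(⟨w k, z⟩ - 1/2): at most 0 on negative points, and at least 2 for the
    -- own colour of a positive point, whence the threshold 1.
    let W : Fin n₀ → Option ι → ℝ := fun k o => o.elim (-8) fun a => 16 * w k a
    have hW : ∀ k p, ∑ o, W k o * x p o = 8 * (∑ a, w k a * z p a - 1 / 2) := by
      intro k p
      rw [Fintype.sum_option]
      simp only [W, x, Option.elim]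
      have : ∀ a, 16 * w k a * (z p a / 2) = 8 * (w k a * z p a) := fun a => by ring
      simp_rw [this]
      rw [← Finset.mul_sum]
      ring
    refine ⟨Fin n₀, inferInstance, fun _ => 1, W, n₀, 64 * n₀ + 576 * m, by simpa using hn, hn₀',
      by simp, ?_, hT, fun p => ⟨fun hp => ?_, fun hp => ?_⟩⟩
    · have : ∀ k, ∑ o, W k o ^ 2 = 64 + 256 * ∑ a, w k a ^ 2 := fun k => by
        rw [Fintype.sum_option]
        simp only [W, Option.elim, mul_pow]
        rw [← Finset.mul_sum]
        norm_num
      simp_rw [this]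
      rw [Finset.sum_add_distrib, ← Finset.mul_sum]
      simp only [Finset.sum_const, Finset.card_univ, Fintype.card_fin, nsmul_eq_mul]
      linarith
    · refine (Finset.sum_nonpos fun k _ => ?_).trans (by norm_num)
      rw [hW, relu_of_nonpos (by linarith [hneg p (by simp [hp]) k]), mul_zero]
    · have h1 := Finset.single_le_sum (f := fun k => (1 : ℝ) * relu (∑ o, W k o * x p o))
        (fun k _ => by rw [one_mul]; exact relu_nonneg _) (Finset.mem_univ (κ p))
      refine le_trans ?_ h1
      simp only [one_mul]
      refine le_trans ?_ (le_relu _)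
      rw [hW]
      linarith [hpos p hp])
  simpa using h

/-- Bertrand's postulate at h = ⌊√((d - 1)/4)⌋; the spare dimension is for the bias coordinate. -/
theorem exists_prime_sq_lt {d : ℕ} (hd : 5 ≤ d) : ∃ q : ℕ, q.Prime ∧ q * q + 1 ≤ d ∧ d ≤ 4 * (q * q) := by
  set h := Nat.sqrt ((d - 1) / 4) with hh
  have h1 : h * h ≤ (d - 1) / 4 := Nat.sqrt_le _
  have h2 : (d - 1) / 4 < (h + 1) * (h + 1) := Nat.lt_succ_sqrt _
  have h0 : h ≠ 0 := by
    have : 0 < h := Nat.sqrt_pos.2 (by omega)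
    omega
  obtain ⟨q, hq, hlt, hle⟩ := Nat.exists_prime_lt_and_le_two_mul h h0
  have h3 : q * q ≤ 2 * h * (2 * h) := Nat.mul_le_mul hle hle
  have h4 : (h + 1) * (h + 1) ≤ q * q := Nat.mul_le_mul hlt hlt
  have h5 : 2 * h * (2 * h) = 4 * (h * h) := by ring
  exact ⟨q, hq, by omega, by omega⟩

/-! ### The two regimes of dimension and the conclusion. -/

theorem canShatterAtLeast_high_dim {n d : ℕ} {b B bx ε l Z : ℝ} (hb : 0 < b) (hB : 0 < B)
    (hbx : 0 < bx) (hε : 0 < ε) (hZ : 3 ≤ Z) (hl : l = Real.log Z) (hnZ : (n : ℝ) ≤ Z)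
    (hdZ : (d : ℝ) ≤ Z) (hd : 10 ^ 6 * l ^ 4 ≤ d)
    (hM : (d : ℝ) < shatterRate n d b B bx ε / (10 ^ 12 * l ^ 4)) :
    CanShatterAtLeast (frobeniusClass relu b B n d) {x | ‖x‖ ≤ bx}
      (shatterRate n d b B bx ε / (10 ^ 12 * l ^ 4)) ε := by
  have hl1 : 1 ≤ l := by
    rw [hl, Real.le_log_iff_exp_le (by linarith)]
    linarith [Real.exp_one_lt_d9]
  have hl4 : 1 ≤ l ^ 4 := one_le_pow₀ hl1
  have hexp : Real.exp l = Z := by rw [hl, Real.exp_log (by linarith)]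
  set T := b * B * bx / ε with hTdef
  have hT0 : 0 < T := by positivity
  set Λ := 10 ^ 12 * l ^ 4 with hΛ
  have hΛ1 : 10 ^ 12 ≤ Λ := by rw [hΛ]; linarith
  have hΛ0 : 0 < Λ := by linarith
  have hd1 : (10 : ℝ) ^ 6 ≤ d := by linarith
  have hd0 : (0 : ℝ) < d := by linarith
  have hdN : 5 ≤ d := by
    have : (5 : ℝ) ≤ d := by linarith
    exact_mod_cast this
  have hsd : 0 < √(d : ℝ) := Real.sqrt_pos.2 hd0
  have hsd2 : √(d : ℝ) * √(d : ℝ) = d := Real.mul_self_sqrt hd0.le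
  -- ρ is the useful width: when T is the bottleneck, fewer than n neurons are used.
  set ρ := min (n : ℝ) (T / √(d : ℝ)) with hρ
  have hrate : shatterRate n d b B bx ε = ρ * d := by
    rw [shatterRate, hρ, min_mul_of_nonneg _ _ hd0.le]
    congr 1
    rw [← hTdef]
    calc T * √(d : ℝ) = T * (√(d : ℝ) * √(d : ℝ)) / √(d : ℝ) := by field_simp
      _ = T / √(d : ℝ) * d := by rw [hsd2]; ring
  rw [hrate] at hM ⊢
  set M := ρ * d / Λ with hMdef
  have hρΛ : Λ < ρ := by
    rw [hMdef, lt_div_iff₀ hΛ0, mul_comm] at hM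
    exact lt_of_mul_lt_mul_right hM hd0.le
  set n₀ := ⌊ρ⌋₊ with hn₀
  have hn₀ρ : (n₀ : ℝ) ≤ ρ := Nat.floor_le (by linarith)
  have hn₀2 : ρ ≤ 2 * n₀ := by
    have := Nat.lt_floor_add_one ρ
    linarith
  have hn₀8 : 8 ≤ n₀ := Nat.le_floor (by push_cast; linarith)
  have hn₀n : (n₀ : ℝ) ≤ n := hn₀ρ.trans (min_le_left _ _)
  have hn₀T : n₀ * √(d : ℝ) ≤ T := (le_div_iff₀ hsd).1 (hn₀ρ.trans (min_le_right _ _))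
  have hn₀0 : (0 : ℝ) < n₀ := by linarith
  set m := ⌈M⌉₊ with hm
  have hmM : (m : ℝ) ≤ 2 * M := by
    have := Nat.ceil_lt_add_one (show 0 ≤ M by linarith)
    linarith
  have hmΛ : m * Λ ≤ 4 * n₀ * d := by
    calc m * Λ ≤ 2 * M * Λ := by gcongr
      _ = 2 * ρ * d := by rw [hMdef]; field_simp
      _ ≤ 2 * (2 * n₀) * d := by gcongr
      _ = 4 * n₀ * d := by ring
  have hmn₀ : 10 ^ 11 * (m : ℝ) ≤ n₀ * d := by
    have := mul_le_mul_of_nonneg_left hΛ1 (Nat.cast_nonneg (α := ℝ) m)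
    linarith
  have hm0 : (0 : ℝ) ≤ m := Nat.cast_nonneg m
  have hmZ : (m : ℝ) ≤ Z * Z := by
    have h1 : (m : ℝ) ≤ n₀ * d := by linarith
    exact h1.trans (mul_le_mul (hn₀n.trans hnZ) hdZ hd0.le (by linarith))
  obtain ⟨q, hq, hqd, hdq⟩ := exists_prime_sq_lt hdN
  have : Fact q.Prime := ⟨hq⟩
  have hdq' : (d : ℝ) ≤ 4 * ((q : ℝ) * q) := by exact_mod_cast hdq
  have hq0 : (0 : ℝ) < q := Nat.cast_pos.2 hq.pos
  -- Since log 2 > 1/2, already 2^r ≥ Z² ≥ m, whatever the prime q.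
  set r := ⌈4 * l⌉₊ with hr
  have hr1 : 4 * l ≤ r := Nat.le_ceil _
  have hr2 : (r : ℝ) ≤ 5 * l := by
    have := Nat.ceil_lt_add_one (show 0 ≤ 4 * l by linarith)
    linarith
  have hmq : m ≤ q ^ r := by
    have h1 : (m : ℝ) ≤ 2 ^ r := by
      calc (m : ℝ) ≤ Z * Z := hmZ
        _ = Real.exp (2 * l) := by rw [two_mul, Real.exp_add, hexp]
        _ ≤ Real.exp (r * Real.log 2) := by
            apply Real.exp_le_exp.2
            calc 2 * l ≤ 4 * l * Real.log 2 := by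
                  have := mul_le_mul_of_nonneg_left Real.log_two_gt_d9.le (zero_le_one.trans hl1)
                  linarith
              _ ≤ r * Real.log 2 := mul_le_mul_of_nonneg_right hr1 (Real.log_pos one_lt_two).le
        _ = 2 ^ r := by rw [Real.exp_nat_mul, Real.exp_log two_pos]
    have h2 : m ≤ 2 ^ r := by exact_mod_cast h1
    exact h2.trans (Nat.pow_le_pow_left hq.two_le r)
  obtain ⟨z, hz1, hz⟩ := exists_incoherent_vectors q r m hmq
  have hα2 : ((r : ℝ) / q) ^ 2 * d ≤ 100 * l ^ 2 := by
    rw [div_pow, div_mul_eq_mul_div, div_le_iff₀ (by positivity)]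
    have h1 : (r : ℝ) ^ 2 ≤ (5 * l) ^ 2 := by gcongr
    calc (r : ℝ) ^ 2 * d ≤ (5 * l) ^ 2 * (4 * ((q : ℝ) * q)) := by gcongr
      _ = _ := by ring
  have hα0 : 0 ≤ (r : ℝ) / q := by positivity
  set α := (r : ℝ) / q with hα
  have htα : 64 * l * α ≤ 1 := by
    have h1 : (64 * l * α) ^ 2 * d ≤ 1 ^ 2 * d := by
      calc (64 * l * α) ^ 2 * d = 4096 * l ^ 2 * (α ^ 2 * d) := by ring
        _ ≤ 4096 * l ^ 2 * (100 * l ^ 2) := by gcongr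
        _ = 409600 * l ^ 4 := by ring
        _ ≤ 1 ^ 2 * d := by linarith
    exact (pow_le_pow_iff_left₀ (by positivity) zero_le_one two_ne_zero).1
      (le_of_mul_le_mul_right h1 hd0)
  -- L = 4l gives e^L = Z^4, enough for the union bound, and t = 64l is then forced by 2L ≤ t/8. The
  -- condition tα ≤ 1 is what requires d of order l^4.
  have hshat := canShatterAtLeast_incoherent (n₀ := n₀) (n := n) (d := d) (t := 64 * l) (L := 4 * l)
    hb hB hbx hε (by simpa [ZMod.card] using hqd) hn₀8 (by exact_mod_cast hn₀n) z hz1 hz hα0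
    (by linarith [mul_le_mul_of_nonneg_right hl1 hα0]) (by linarith) htα ?_ (by linarith) ?_ ?_
  · exact hshat.mono_rate (Nat.le_ceil M)
  · have h1 : (64 * l) ^ 2 * (m * α ^ 2) * (Λ * d) ≤ 1638400 * l ^ 4 * (n₀ * d) := by
      calc (64 * l) ^ 2 * (m * α ^ 2) * (Λ * d) = (64 * l) ^ 2 * (m * Λ) * (α ^ 2 * d) := by ring
        _ ≤ (64 * l) ^ 2 * (4 * n₀ * d) * (100 * l ^ 2) := by gcongr
        _ = _ := by ring
    have h2 : 1638400 * l ^ 4 * (n₀ * d) ≤ (4 * l * n₀) * (Λ * d) := by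
      have : 1638400 * l ^ 4 ≤ 4 * l * Λ := by
        rw [hΛ]
        linarith [mul_le_mul_of_nonneg_right hl1 (zero_le_one.trans hl4)]
      calc 1638400 * l ^ 4 * (n₀ * d) ≤ 4 * l * Λ * (n₀ * d) := by gcongr
        _ = _ := by ring
    rw [← mul_div_assoc, div_le_iff₀ hn₀0]
    exact le_of_mul_le_mul_right (h1.trans h2) (by positivity)
  · have h1 : Real.exp (4 * l) = Z ^ 4 := by
      rw [← hexp, ← Real.exp_nat_mul]
      norm_num
    rw [h1]
    have hZ3 : 0 < Z ^ 3 := by positivity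
    calc 2 * n₀ * (m : ℝ) ≤ 2 * Z * (Z * Z) := by
          have := hn₀n.trans hnZ
          gcongr
      _ < Z ^ 4 := by linarith [mul_le_mul_of_nonneg_right hZ hZ3.le]
  · have h1 : (n₀ * √(d : ℝ)) ^ 2 ≤ T ^ 2 := by gcongr
    have h2 : (n₀ * √(d : ℝ)) ^ 2 = n₀ ^ 2 * d := by rw [mul_pow, Real.sq_sqrt hd0.le]
    rw [h2] at h1
    refine le_trans ?_ h1
    have h3 : 576 * (m : ℝ) ≤ n₀ * d / 2 := by linarith
    have h4 : 64 * (n₀ : ℝ) ≤ n₀ * d / 2 := by linarith [mul_le_mul_of_nonneg_left hd1 hn₀0.le]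
    calc (n₀ : ℝ) * (64 * n₀ + 576 * m) ≤ n₀ * (n₀ * d / 2 + n₀ * d / 2) := by gcongr
      _ = n₀ ^ 2 * d := by ring

/-- Here 10^12 l^4 ≥ 10^6 d, so dividing the rate by it leaves M ≤ 10^(-6) min(n, T). This regime is
the one that dictates the constant 10^12 and the power 4. -/
theorem canShatterAtLeast_low_dim {n d : ℕ} {b B bx ε l : ℝ} (hb : 0 < b) (hB : 0 < B)
    (hbx : 0 < bx) (hε : 0 < ε) (hl1 : 1 ≤ l) (hd5 : 5 ≤ d) (hd : (d : ℝ) ≤ 10 ^ 6 * l ^ 4)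
    (hM : (d : ℝ) < shatterRate n d b B bx ε / (10 ^ 12 * l ^ 4)) :
    CanShatterAtLeast (frobeniusClass relu b B n d) {x | ‖x‖ ≤ bx}
      (shatterRate n d b B bx ε / (10 ^ 12 * l ^ 4)) ε := by
  set T := b * B * bx / ε with hTdef
  have hT0 : 0 < T := by positivity
  have hd1 : (5 : ℝ) ≤ d := by exact_mod_cast hd5
  have hΛ0 : 0 < 10 ^ 12 * l ^ 4 := by positivity
  set M := shatterRate n d b B bx ε / (10 ^ 12 * l ^ 4) with hMdef
  have hM1 : 1 ≤ M := by linarith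
  have hMΛ : M * (10 ^ 6 * d) ≤ shatterRate n d b B bx ε := by
    calc M * (10 ^ 6 * d) ≤ M * (10 ^ 12 * l ^ 4) := by
          apply mul_le_mul_of_nonneg_left _ (by linarith)
          linarith
      _ = _ := by rw [hMdef]; field_simp
  have hMn : M * 10 ^ 6 ≤ n := by
    have h1 : M * (10 ^ 6 * d) ≤ n * d := hMΛ.trans (min_le_left _ _)
    exact le_of_mul_le_mul_right (by linarith) (show (0 : ℝ) < d by linarith)
  have hMT : M * 10 ^ 6 ≤ T := by
    have h1 : M * (10 ^ 6 * d) ≤ T * √(d : ℝ) := hMΛ.trans (min_le_right _ _)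
    have h2 : √(d : ℝ) ≤ d := Real.sqrt_le_iff.2 ⟨by linarith, by nlinarith⟩
    have h3 : T * √(d : ℝ) ≤ T * d := by gcongr
    exact le_of_mul_le_mul_right (by linarith) (show (0 : ℝ) < d by linarith)
  -- Rounding the fourth root up costs at most a factor 16 in N^4, and 3000 · 16 ≤ 10^6.
  set N := ⌈√(√M)⌉₊ with hN
  have h1 : 1 ≤ √(√M) := Real.one_le_sqrt.2 (Real.one_le_sqrt.2 hM1)
  have h4 : √(√M) ^ 4 = M := by
    rw [show 4 = 2 * 2 from rfl, pow_mul, Real.sq_sqrt (Real.sqrt_nonneg _),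
      Real.sq_sqrt (by linarith)]
  have hN1 : √(√M) ≤ N := Nat.le_ceil _
  have hN2 : (N : ℝ) ≤ 2 * √(√M) := by
    have := Nat.ceil_lt_add_one (show 0 ≤ √(√M) by linarith)
    linarith
  have hN4 : (N : ℝ) ^ 4 ≤ 16 * M := by
    calc (N : ℝ) ^ 4 ≤ (2 * √(√M)) ^ 4 := by gcongr
      _ = 16 * M := by rw [mul_pow, h4]; norm_num
  have hNM : M ≤ (N : ℝ) ^ 4 := by
    rw [← h4]
    gcongr
  refine (canShatterAtLeast_grid (N := N) (Nat.cast_pos.1 (lt_of_lt_of_le (by linarith) hN1)) hd5 hb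
    hB hbx hε ?_ ?_).mono_rate hNM
  · have : (N : ℝ) ^ 4 + 1 ≤ n := by linarith
    exact_mod_cast this
  · linarith

/-- Plain ReLU networks attain the shattering rate up to a polylogarithmic factor. -/
theorem canShatterAtLeast_shatterRate {n d : ℕ} {b B bx ε : ℝ} (hb : 0 < b) (hB : 0 < B)
    (hbx : 0 < bx) (hε : 0 < ε) (hd5 : 5 ≤ d)
    (hM : (d : ℝ) < shatterRate n d b B bx ε / polylog (10 ^ 12) 4 n d b B bx ε) :
    CanShatterAtLeast (frobeniusClass relu b B n d) {x | ‖x‖ ≤ bx}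
      (shatterRate n d b B bx ε / polylog (10 ^ 12) 4 n d b B bx ε) ε := by
  unfold polylog at hM ⊢
  have hn0 : (0 : ℝ) ≤ n := Nat.cast_nonneg n
  have hd0 : (0 : ℝ) ≤ d := Nat.cast_nonneg d
  have hε' : 0 < 1 / ε := by positivity
  set Z : ℝ := 3 + d + n + b + B + bx + 1 / ε with hZ
  have hl1 : 1 ≤ Real.log Z := by
    rw [Real.le_log_iff_exp_le (by linarith)]
    linarith [Real.exp_one_lt_d9]
  rcases le_total (10 ^ 6 * Real.log Z ^ 4) (d : ℝ) with h | h
  · exact canShatterAtLeast_high_dim hb hB hbx hε (by linarith) rfl (by linarith) (by linarith) h hM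
  · exact canShatterAtLeast_low_dim hb hB hbx hε hl1 hd5 h hM

theorem corollary1 :
    ∃ (C C' c : ℝ) (k k' d₀ : ℕ), 0 < C ∧ 0 < C' ∧ 0 < c ∧
      ∀ (n d : ℕ) (b B bx ε : ℝ), 0 < n → d₀ ≤ d → 0 < b → 0 < B → 0 < bx → 0 < ε →
        (c * d < shatterRate n d b B bx ε / polylog C k n d b B bx ε →
          (∃ β : ℝ, AdmissibleBias (polylog C k n d b B bx ε) n d b B bx ε β) ∧
          (∀ β : ℝ, AdmissibleBias (polylog C k n d b B bx ε) n d b B bx ε β →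
            β ≤ B * bx / √(n : ℝ) →
              CanShatterAtLeast (frobeniusClass relu b B n d) {x | ‖x‖ ≤ bx}
                (shatterRate n d b B bx ε / polylog C k n d b B bx ε) ε)) ∧
        (polylog C' k' n d b B bx ε ≤ d →
          ∀ β : ℝ, 0 ≤ β → β ≤ polylog C k n d b B bx ε * (B * bx / √((d : ℝ) * n)) →
            β ≤ B * bx / √(n : ℝ)) := by
  -- C' = C² and k' = 2k make Λ' = Λ²; d₀ = 5 is four grid coordinates plus one for the bias.
  refine ⟨10 ^ 12, (10 ^ 12) ^ 2, 1, 4, 8, 5, by positivity, by positivity, one_pos, ?_⟩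
  intro n d b B bx ε hn hd hb hB hbx hε
  have hlog : 0 ≤ Real.log (3 + d + n + b + B + bx + 1 / ε) := by
    have hn0 : (0 : ℝ) ≤ n := Nat.cast_nonneg n
    have hd0 : (0 : ℝ) ≤ d := Nat.cast_nonneg d
    have hε' : 0 < 1 / ε := by positivity
    exact Real.log_nonneg (by linarith)
  have hΛ0 : 0 ≤ polylog (10 ^ 12) 4 n d b B bx ε := by unfold polylog; positivity
  refine ⟨fun hM => ?_, fun hd' β _ hβ => hβ.trans ?_⟩
  · rw [one_mul] at hM
    have hshat := canShatterAtLeast_shatterRate hb hB hbx hε hd hM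
    refine ⟨⟨0, le_rfl, by positivity, ?_⟩, fun _ _ _ => hshat⟩
    simpa only [sub_zero] using hshat
  · have hd0 : (0 : ℝ) < d := Nat.cast_pos.2 (by omega)
    have hΛd : polylog (10 ^ 12) 4 n d b B bx ε ≤ √(d : ℝ) := by
      apply Real.le_sqrt_of_sq_le
      refine le_trans (le_of_eq ?_) hd'
      unfold polylog
      ring
    have hn0 : (0 : ℝ) < n := Nat.cast_pos.2 hn
    calc polylog (10 ^ 12) 4 n d b B bx ε * (B * bx / √((d : ℝ) * n))
        ≤ √(d : ℝ) * (B * bx / √((d : ℝ) * n)) := by gcongr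
      _ = B * bx / √(n : ℝ) := by
          rw [Real.sqrt_mul hd0.le]
          have := Real.sqrt_pos.2 hd0
          field_simp
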